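/- Let $\mathtt{Prop}$ be a countable set of propositional variables. Let $\mathscr{L}_{\mathsf{CPL}}$ be the set of classical propositional formulas $\phi ::= p\mid{\sim}\phi\mid(\phi\wedge\phi)$, $p\in\mathtt{Prop}$, with $\phi\supset\chi:={\sim}(\phi\wedge{\sim}\chi)$, and write $\mathsf{CPL}\vdash\phi$ if $\phi$ is provable in classical propositional logic. Let $\mathscr{L}_{\mathsf{QG}}$ be given by $$\alpha ::= \mathtt{B}\phi\mid(\alpha\wedge\alpha)\mid(\alpha\vee\alpha)\mid(\alpha\to\alpha)\mid(\alpha\prec\alpha)\qquad(\phi\in\mathscr{L}_{\mathsf{CPL}}),$$ and abbreviate $\top:=\tau\to\tau$, $\bot:=\tau\prec\tau$ (for any $\tau\in\mathscr{L}_{\mathsf{QG}}$), $\neg\alpha:=\alpha\to\bot$ and $\triangle\alpha:=(\top\prec\alpha)\to\bot$. *Semantics.* A model consists of a non-empty set $W$, a valuation $v:\mathtt{Prop}\to2^W$ and an uncertainty measure $\mu:2^W\to[0,1]$, i.e. $X\subseteq Y$ implies $\mu(X)\le\mu(Y)$, and $\mu(\varnothing)<\mu(W)$. Classical formulas are evaluated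 at the points of $W$ as usual; let $\|\phi\|\subseteq W$ be the set of points where $\phi$ holds. The value $e(\alpha)\in[0,1]$ is defined by $e(\mathtt{B}\phi)=\mu(\|\phi\|)$, $e(\alpha\wedge\beta)=\min(e(\alpha),e(\beta))$, $e(\alpha\vee\beta)=\max(e(\alpha),e(\beta))$; $e(\alpha\to\beta)=1$ if $e(\alpha)\le e(\beta)$ and $e(\alpha\to\beta)=e(\beta)$ otherwise; $e(\alpha\prec\beta)=0$ if $e(\alpha)\le e(\beta)$ and $e(\alpha\prec\beta)=e(\alpha)$ otherwise. For $\Xi\cup\{\alpha\}\subseteq\mathscr{L}_{\mathsf{QG}}$, write $\Xi\models_{\mathsf{QG}}\alpha$ if $\inf\{e(\gamma):\gamma\in\Xi\}\le e(\alpha)$ in every model (with $\inf\varnothing=1$). *Calculus.* $\mathcal{H}\mathsf{QG}$ has the following axioms, for all $\alpha,\beta,\gamma\in\mathscr{L}_{\mathsf{QG}}$ and $\phi,\chi\in\mathscr{L}_{\mathsf{CPL}}$: 1. $(\alpha\to\beta)\to((\beta\to\gamma)\to(\alpha\to\gamma))$; 2. $\alpha\to(\alpha\vee\beta)$; $\beta\to(\alpha\vee\beta)$;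 3. $(\alpha\to\gamma)\to((\beta\to\gamma)\to((\alpha\vee\beta)\to\gamma))$; 4. $(\alpha\wedge\beta)\to\alpha$; $(\alpha\wedge\beta)\to\beta$; 5. $(\alpha\to\beta)\to((\alpha\to\gamma)\to(\alpha\to(\beta\wedge\gamma)))$; 6. $(\alpha\to(\beta\to\gamma))\to((\alpha\wedge\beta)\to\gamma)$; $((\alpha\wedge\beta)\to\gamma)\to(\alpha\to(\beta\to\gamma))$; 7. $(\alpha\to\beta)\to(\neg\beta\to\neg\alpha)$; 8. $(\alpha\prec\beta)\to(\top\prec(\alpha\to\beta))$; $\neg(\alpha\prec\beta)\to(\alpha\to\beta)$; 9. $\alpha\to(\beta\vee(\alpha\prec\beta))$; $((\alpha\prec\beta)\prec\gamma)\to(\alpha\prec(\beta\vee\gamma))$; 10. (prelinearity) $(\alpha\to\beta)\vee(\beta\to\alpha)$; $\neg((\alpha\prec\beta)\wedge(\beta\prec\alpha))$; 11. (nontriv) $\neg\triangle(\mathtt{B}\phi\to\mathtt{B}\chi)$ whenever $\mathsf{CPL}\vdash\phi$ and $\mathsf{CPL}\vdash{\sim}\chi$; 12. (reg) $\mathtt{B}\phi\to\mathtt{B}\chi$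 whenever $\mathsf{CPL}\vdash\phi\supset\chi$. The rules are modus ponens (from $\alpha$ and $\alpha\to\beta$ infer $\beta$) and necessitation, which applies to theorems only (from $\vdash\alpha$ infer $\vdash\triangle\alpha$). Write $\Xi\vdash_{\mathcal{H}\mathsf{QG}}\alpha$ if $\alpha$ has a finite derivation in which every formula is an axiom, a member of $\Xi$, or obtained by a rule, necessitation being applied only to formulas derivable from no assumptions. **Theorem.** For every (possibly infinite) set $\Xi\cup\{\alpha\}\subseteq\mathscr{L}_{\mathsf{QG}}$, $$\Xi\models_{\mathsf{QG}}\alpha\quad\text{if and only if}\quad\Xi\vdash_{\mathcal{H}\mathsf{QG}}\alpha.$$ -/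

import Mathlib

universe u w

/-- Formulas of classical propositional logic over the variables `V`,
in the language with negation and conjunction. -/
inductive CPLForm (V : Type u) : Type u
  | var (p : V) : CPLForm V
  | neg (φ : CPLForm V) : CPLForm V
  | and (φ ψ : CPLForm V) : CPLForm V

namespace CPLForm

/-- The defined material implication `φ ⊃ ψ := ∼(φ ∧ ∼ψ)`. -/
def imp {V : Type u} (φ ψ : CPLForm V) : CPLForm V :=
  neg (and φ (neg ψ))

/-- Natural deduction for classical propositional logic in the language `{∼, ∧}`. -/
inductive Deriv {V : Type u} : Set (CPLForm V) → CPLForm V → Prop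
  | hyp {Γ : Set (CPLForm V)} {φ : CPLForm V} (h : φ ∈ Γ) : Deriv Γ φ
  | andI {Γ : Set (CPLForm V)} {φ ψ : CPLForm V}
      (h₁ : Deriv Γ φ) (h₂ : Deriv Γ ψ) : Deriv Γ (and φ ψ)
  | andE₁ {Γ : Set (CPLForm V)} {φ ψ : CPLForm V} (h : Deriv Γ (and φ ψ)) : Deriv Γ φ
  | andE₂ {Γ : Set (CPLForm V)} {φ ψ : CPLForm V} (h : Deriv Γ (and φ ψ)) : Deriv Γ ψ
  | negI {Γ : Set (CPLForm V)} {φ ψ : CPLForm V}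
      (h₁ : Deriv (insert φ Γ) ψ) (h₂ : Deriv (insert φ Γ) (neg ψ)) : Deriv Γ (neg φ)
  | raa {Γ : Set (CPLForm V)} {φ ψ : CPLForm V}
      (h₁ : Deriv (insert (neg φ) Γ) ψ) (h₂ : Deriv (insert (neg φ) Γ) (neg ψ)) : Deriv Γ φ

/-- `CPL ⊢ φ`. -/
def Provable {V : Type u} (φ : CPLForm V) : Prop :=
  Deriv ∅ φ

end CPLForm

/-- Two-layered formulas: atoms are `B φ` with `φ` classical, and the outer connectives
are those of bi-Gödel logic. -/
inductive QGForm (V : Type u) : Type u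
  | bel (φ : CPLForm V) : QGForm V
  | and (α β : QGForm V) : QGForm V
  | or (α β : QGForm V) : QGForm V
  | imp (α β : QGForm V) : QGForm V
  | coimp (α β : QGForm V) : QGForm V

namespace QGForm

/-- `⊤ := τ → τ`; the formula `τ` plays the role of the variable in the abbreviation. -/
def top {V : Type u} (τ : QGForm V) : QGForm V := imp τ τ

/-- `⊥ := τ ⤙ τ`. -/
def bot {V : Type u} (τ : QGForm V) : QGForm V := coimp τ τ

/-- Gödel negation `α → ⊥`. -/
def neg {V : Type u} (τ α : QGForm V) : QGForm V := imp α (bot τ)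

/-- `△α := (⊤ ⤙ α) → ⊥`. -/
def delta {V : Type u} (τ α : QGForm V) : QGForm V := imp (coimp (top τ) α) (bot τ)

end QGForm

open QGForm in
/-- The instances, with two-layered formulas, of the axiom schemas of the Hilbert calculus
for bi-Gödel logic. In the schemas that mention `⊤` or `⊥`, the auxiliary formula `τ` in
these abbreviations is arbitrary. -/
inductive BiGAxiom {V : Type u} : QGForm V → Prop
  | trans (φ χ ψ : QGForm V) :
      BiGAxiom (imp (imp φ χ) (imp (imp χ ψ) (imp φ ψ)))
  | orI₁ (φ χ : QGForm V) : BiGAxiom (imp φ (or φ χ))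
  | orI₂ (φ χ : QGForm V) : BiGAxiom (imp χ (or φ χ))
  | orE (φ χ ψ : QGForm V) :
      BiGAxiom (imp (imp φ ψ) (imp (imp χ ψ) (imp (or φ χ) ψ)))
  | andE₁ (φ χ : QGForm V) : BiGAxiom (imp (and φ χ) φ)
  | andE₂ (φ χ : QGForm V) : BiGAxiom (imp (and φ χ) χ)
  | andI (φ χ ψ : QGForm V) :
      BiGAxiom (imp (imp φ χ) (imp (imp φ ψ) (imp φ (and χ ψ))))
  | uncurry (φ χ ψ : QGForm V) :
      BiGAxiom (imp (imp φ (imp χ ψ)) (imp (and φ χ) ψ))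
  | curry (φ χ ψ : QGForm V) :
      BiGAxiom (imp (imp (and φ χ) ψ) (imp φ (imp χ ψ)))
  | contra (τ φ χ : QGForm V) :
      BiGAxiom (imp (imp φ χ) (imp (neg τ χ) (neg τ φ)))
  | coimp_top (τ φ χ : QGForm V) :
      BiGAxiom (imp (coimp φ χ) (coimp (top τ) (imp φ χ)))
  | neg_coimp (τ φ χ : QGForm V) :
      BiGAxiom (imp (neg τ (coimp φ χ)) (imp φ χ))
  | coimp_or (φ χ : QGForm V) : BiGAxiom (imp φ (or χ (coimp φ χ)))
  | coimp_coimp (φ χ ψ : QGForm V) :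
      BiGAxiom (imp (coimp (coimp φ χ) ψ) (coimp φ (or χ ψ)))
  | prel (φ χ : QGForm V) : BiGAxiom (or (imp φ χ) (imp χ φ))
  | coprel (τ φ χ : QGForm V) :
      BiGAxiom (neg τ (and (coimp φ χ) (coimp χ φ)))

/-- Derivability from a set of assumptions in the two-layered calculus. The necessitation
rule applies only to theorems, i.e. to formulas derived from no assumptions. -/
inductive QGDerivable {V : Type u} : Set (QGForm V) → QGForm V → Prop
  | hyp {Ξ : Set (QGForm V)} {α : QGForm V} (h : α ∈ Ξ) : QGDerivable Ξ α
  | biG {Ξ : Set (QGForm V)} {α : QGForm V} (h : BiGAxiom α) : QGDerivable Ξ α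
  | nontriv {Ξ : Set (QGForm V)} (τ : QGForm V) {φ χ : CPLForm V}
      (hφ : φ.Provable) (hχ : χ.neg.Provable) :
      QGDerivable Ξ (QGForm.neg τ (QGForm.delta τ (QGForm.imp (QGForm.bel φ) (QGForm.bel χ))))
  | reg {Ξ : Set (QGForm V)} {φ φ' : CPLForm V} (h : (φ.imp φ').Provable) :
      QGDerivable Ξ (QGForm.imp (QGForm.bel φ) (QGForm.bel φ'))
  | mp {Ξ : Set (QGForm V)} {α β : QGForm V}
      (h₁ : QGDerivable Ξ α) (h₂ : QGDerivable Ξ (QGForm.imp α β)) : QGDerivable Ξ β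
  | nec {Ξ : Set (QGForm V)} (τ : QGForm V) {α : QGForm V}
      (h : QGDerivable ∅ α) : QGDerivable Ξ (QGForm.delta τ α)

/-- An uncertainty measure on `W`: a monotone and non-trivial function from the powerset
of `W` to `[0,1]`. -/
structure UncertaintyMeasure (W : Type w) where
  /-- the underlying set function -/
  toFun : Set W → unitInterval
  mono : ∀ X Y : Set W, X ⊆ Y → toFun X ≤ toFun Y
  nontrivial : toFun ∅ < toFun Set.univ

/-- A model of the two-layered logic: a non-empty set of states with an uncertainty measure
and a classical valuation of the variables. The outer valuation is determined by these
(see `QGModel.eval`). -/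
structure QGModel (V : Type u) where
  /-- the set of states -/
  W : Type w
  nonempty : Nonempty W
  /-- the valuation of the propositional variables -/
  v : V → Set W
  /-- the uncertainty measure -/
  μ : UncertaintyMeasure W

namespace QGModel

/-- Satisfaction of classical formulas at a state. -/
def Sat {V : Type u} (M : QGModel.{u, w} V) (x : M.W) : CPLForm V → Prop
  | .var p => x ∈ M.v p
  | .neg φ => ¬ M.Sat x φ
  | .and φ ψ => M.Sat x φ ∧ M.Sat x ψ

/-- The event `‖φ‖`. -/
def ext {V : Type u} (M : QGModel.{u, w} V) (φ : CPLForm V) : Set M.W :=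
  {x | M.Sat x φ}

end QGModel

noncomputable section

/-- Gödel implication on `[0,1]`. -/
def goedelImp (a b : unitInterval) : unitInterval := if a ≤ b then 1 else b

/-- Gödel co-implication `b ⤙ a` on `[0,1]`. -/
def goedelCoimp (b a : unitInterval) : unitInterval := if b ≤ a then 0 else b

/-- The value of a two-layered formula in a model: the bi-Gödel valuation with
`e (B φ) = μ ‖φ‖`. -/
def QGModel.eval {V : Type u} (M : QGModel.{u, w} V) : QGForm V → unitInterval
  | .bel φ => M.μ.toFun (M.ext φ)
  | .and α β => min (M.eval α) (M.eval β)
  | .or α β => max (M.eval α) (M.eval β)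
  | .imp α β => goedelImp (M.eval α) (M.eval β)
  | .coimp α β => goedelCoimp (M.eval α) (M.eval β)

/-- Entailment over all models: in every model, the infimum (in `[0,1]`, so that the infimum
of the empty set is `1`) of the values of the premises is at most the value of the
conclusion. -/
def QGEntails {V : Type u} (Ξ : Set (QGForm V)) (α : QGForm V) : Prop :=
  ∀ M : QGModel.{u, w} V, sInf (M.eval '' Ξ) ≤ M.eval α

end

/-!
For completeness, extend `Ξ` to a prime theory `F` that omits `α`, which exists because the
derivations are finite. Its crisp part `{β | △β ∈ F}` is again a theory, and coprelinearity makes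
`△(β → γ) ∨ △(γ → β)` a theorem, so the Lindenbaum algebra of the crisp part is a countable chain.
It embeds in `[0,1]`, with the value of `α` separated by a gap from all larger values; the gap is
what makes an infinite `Ξ` harmless, since no premise can have a value at or below that of `α`
(`γ → α` is outside `F` for each `γ ∈ Ξ`). Prelinearity and residuation turn the embedding into a
bi-Gödel valuation. By classical completeness and regularity, the value of `B φ` depends
monotonically on the set of classical valuations satisfying `φ`, hence extends to an uncertainty
measure on the set of all classical valuations.
-/

namespace CPLForm

variable {V : Type u}

/-- An injective Gödel numbering of the classical formulas, given one of the variables. -/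
def encode (f : V → ℕ) : CPLForm V → ℕ
  | var p => Nat.pair 0 (f p)
  | neg φ => Nat.pair 1 (encode f φ)
  | and φ ψ => Nat.pair 2 (Nat.pair (encode f φ) (encode f ψ))

theorem encode_injective {f : V → ℕ} (hf : Function.Injective f) :
    Function.Injective (encode f) := by
  intro φ
  induction φ with
  | var p => rintro (_ | _ | _) <;> simp [encode, hf.eq_iff]
  | neg φ ih =>
    rintro (_ | ψ | _) <;> simp only [encode, Nat.pair_eq_pair, neg.injEq] <;> grind
  | and φ₁ φ₂ ih₁ ih₂ =>
    rintro (_ | _ | ⟨ψ₁, ψ₂⟩) <;> simp only [encode, Nat.pair_eq_pair, and.injEq] <;> grind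

instance [Countable V] : Countable (CPLForm V) :=
  have ⟨_, hf⟩ := exists_injective_nat V
  (encode_injective hf).countable

/-- Classical truth of a formula under a valuation of the variables. -/
def Holds (v : V → Prop) : CPLForm V → Prop
  | var p => v p
  | neg φ => ¬ Holds v φ
  | and φ ψ => Holds v φ ∧ Holds v ψ

theorem holds_imp {v : V → Prop} {φ ψ : CPLForm V} :
    (imp φ ψ).Holds v ↔ (φ.Holds v → ψ.Holds v) := by
  simp [imp, Holds]

namespace Deriv

variable {Γ Δ : Set (CPLForm V)} {φ ψ χ : CPLForm V}

theorem mono (h : Deriv Γ φ) (hΓ : Γ ⊆ Δ) : Deriv Δ φ := by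
  induction h generalizing Δ with
  | hyp h => exact .hyp (hΓ h)
  | andI _ _ ih₁ ih₂ => exact .andI (ih₁ hΓ) (ih₂ hΓ)
  | andE₁ _ ih => exact .andE₁ (ih hΓ)
  | andE₂ _ ih => exact .andE₂ (ih hΓ)
  | negI _ _ ih₁ ih₂ =>
    exact .negI (ih₁ (Set.insert_subset_insert hΓ)) (ih₂ (Set.insert_subset_insert hΓ))
  | raa _ _ ih₁ ih₂ =>
    exact .raa (ih₁ (Set.insert_subset_insert hΓ)) (ih₂ (Set.insert_subset_insert hΓ))

theorem holds {v : V → Prop} (h : Deriv Γ φ) (hΓ : ∀ ψ ∈ Γ, ψ.Holds v) : φ.Holds v := by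
  induction h with
  | hyp h => exact hΓ _ h
  | andI _ _ ih₁ ih₂ => exact ⟨ih₁ hΓ, ih₂ hΓ⟩
  | andE₁ _ ih => exact (ih hΓ).1
  | andE₂ _ ih => exact (ih hΓ).2
  | negI _ _ ih₁ ih₂ =>
    intro hφ
    have hins := Set.forall_mem_insert.2 ⟨hφ, hΓ⟩
    exact ih₂ hins (ih₁ hins)
  | raa _ _ ih₁ ih₂ =>
    by_contra hφ
    have hins := Set.forall_mem_insert (P := Holds v) (a := neg _) |>.2 ⟨hφ, hΓ⟩
    exact ih₂ hins (ih₁ hins)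

theorem exists_finite_insert (h₁ : ∃ s ⊆ insert χ Γ, s.Finite ∧ Deriv s φ)
    (h₂ : ∃ s ⊆ insert χ Γ, s.Finite ∧ Deriv s ψ) :
    ∃ s ⊆ Γ, s.Finite ∧ Deriv (insert χ s) φ ∧ Deriv (insert χ s) ψ := by
  obtain ⟨s, hs, hsf, ds⟩ := h₁
  obtain ⟨t, ht, htf, dt⟩ := h₂
  have hst : s ∪ t ⊆ insert χ ((s ∪ t) \ {χ}) := Set.subset_insert_sdiff_singleton χ _
  exact ⟨(s ∪ t) \ {χ}, Set.sdiff_singleton_subset_iff.2 (Set.union_subset hs ht),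
    (hsf.union htf).sdiff, ds.mono (Set.subset_union_left.trans hst),
    dt.mono (Set.subset_union_right.trans hst)⟩

theorem exists_finite (h : Deriv Γ φ) : ∃ s ⊆ Γ, s.Finite ∧ Deriv s φ := by
  induction h with
  | hyp h => exact ⟨{_}, Set.singleton_subset_iff.2 h, Set.finite_singleton _, .hyp rfl⟩
  | andI _ _ ih₁ ih₂ =>
    obtain ⟨s, hs, hsf, ds⟩ := ih₁
    obtain ⟨t, ht, htf, dt⟩ := ih₂
    exact ⟨s ∪ t, Set.union_subset hs ht, hsf.union htf,
      .andI (ds.mono Set.subset_union_left) (dt.mono Set.subset_union_right)⟩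
  | andE₁ _ ih => exact ih.imp fun _ ⟨hs, hsf, ds⟩ => ⟨hs, hsf, .andE₁ ds⟩
  | andE₂ _ ih => exact ih.imp fun _ ⟨hs, hsf, ds⟩ => ⟨hs, hsf, .andE₂ ds⟩
  | negI _ _ ih₁ ih₂ =>
    exact (exists_finite_insert ih₁ ih₂).imp fun _ ⟨hs, hsf, d₁, d₂⟩ => ⟨hs, hsf, .negI d₁ d₂⟩
  | raa _ _ ih₁ ih₂ =>
    exact (exists_finite_insert ih₁ ih₂).imp fun _ ⟨hs, hsf, d₁, d₂⟩ => ⟨hs, hsf, .raa d₁ d₂⟩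

theorem isOfFiniteCharacter_not (φ : CPLForm V) :
    Order.IsOfFiniteCharacter {Γ | ¬ Deriv Γ φ} := fun _ =>
  ⟨fun h _ hs _ d => h (d.mono hs), fun h d =>
    have ⟨s, hs, hsf, ds⟩ := d.exists_finite
    h s hs hsf ds⟩

theorem by_cases (h₁ : Deriv (insert ψ Γ) φ) (h₂ : Deriv (insert (neg ψ) Γ) φ) : Deriv Γ φ := by
  have hsub {χ : CPLForm V} : insert χ Γ ⊆ insert χ (insert (neg φ) Γ) :=
    Set.insert_subset_insert (Set.subset_insert _ _)
  have hneg {χ : CPLForm V} : Deriv (insert χ (insert (neg φ) Γ)) (neg φ) :=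
    .hyp (.inr (.inl rfl))
  exact .raa (.raa (h₂.mono hsub) hneg) (.negI (h₁.mono hsub) hneg)

end Deriv

section Maximal

variable {Γ : Set (CPLForm V)} {φ ψ : CPLForm V} (hΓ : Maximal (fun Δ => ¬ Deriv Δ φ) Γ)

include hΓ

theorem mem_of_maximal_of_deriv (d : Deriv Γ ψ) : ψ ∈ Γ := by
  by_contra hψ
  have hφ : Deriv (insert ψ Γ) φ := not_not.1 (mt hΓ.mem_of_prop_insert hψ)
  refine hΓ.prop (.by_cases hφ (.raa (ψ := ψ) (d.mono ?_) (.hyp (.inr (.inl rfl)))))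
  exact (Set.subset_insert _ _).trans (Set.subset_insert _ _)

theorem neg_mem_iff_of_maximal : neg ψ ∈ Γ ↔ ψ ∉ Γ := by
  refine ⟨fun hneg hψ => hΓ.prop (.raa (.hyp (.inr hψ)) (.hyp (.inr hneg))), fun hψ => ?_⟩
  by_contra hneg
  exact hΓ.prop (.by_cases (not_not.1 (mt hΓ.mem_of_prop_insert hψ))
    (not_not.1 (mt hΓ.mem_of_prop_insert hneg)))

theorem holds_iff_mem_of_maximal : ψ.Holds (fun p => var p ∈ Γ) ↔ ψ ∈ Γ := by
  induction ψ with
  | var p => rfl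
  | neg ψ ih => exact (not_congr ih).trans (neg_mem_iff_of_maximal hΓ).symm
  | and ψ χ ih₁ ih₂ =>
    refine (and_congr ih₁ ih₂).trans ⟨fun h => ?_, fun h => ⟨?_, ?_⟩⟩
    · exact mem_of_maximal_of_deriv hΓ (.andI (.hyp h.1) (.hyp h.2))
    · exact mem_of_maximal_of_deriv hΓ (.andE₁ (.hyp h))
    · exact mem_of_maximal_of_deriv hΓ (.andE₂ (.hyp h))

end Maximal

theorem provable_iff_forall_holds {φ : CPLForm V} : φ.Provable ↔ ∀ v, φ.Holds v := by
  refine ⟨fun d v => d.holds fun _ h => h.elim, fun h => ?_⟩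
  by_contra hφ
  obtain ⟨Γ, -, hΓ⟩ := (Deriv.isOfFiniteCharacter_not φ).exists_maximal hφ
  exact hΓ.prop (.hyp ((holds_iff_mem_of_maximal hΓ).1 (h _)))

end CPLForm

namespace QGForm

variable {V : Type u}

/-- An injective Gödel numbering of the two-layered formulas, given one of the inner formulas. -/
def encode (f : CPLForm V → ℕ) : QGForm V → ℕ
  | bel φ => Nat.pair 0 (f φ)
  | and α β => Nat.pair 1 (Nat.pair (encode f α) (encode f β))
  | or α β => Nat.pair 2 (Nat.pair (encode f α) (encode f β))
  | imp α β => Nat.pair 3 (Nat.pair (encode f α) (encode f β))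
  | coimp α β => Nat.pair 4 (Nat.pair (encode f α) (encode f β))

theorem encode_injective {f : CPLForm V → ℕ} (hf : Function.Injective f) :
    Function.Injective (encode f) := by
  intro α
  induction α with
  | bel φ => rintro (_ | _ | _ | _ | _) <;> simp [encode, hf.eq_iff]
  | and α₁ α₂ ih₁ ih₂ | or α₁ α₂ ih₁ ih₂ | imp α₁ α₂ ih₁ ih₂ | coimp α₁ α₂ ih₁ ih₂ =>
    rintro (_ | ⟨β₁, β₂⟩ | ⟨β₁, β₂⟩ | ⟨β₁, β₂⟩ | ⟨β₁, β₂⟩) <;>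
      simp only [encode, Nat.pair_eq_pair, and.injEq, or.injEq, imp.injEq, coimp.injEq] <;> grind

instance [Countable V] : Countable (QGForm V) :=
  have ⟨_, hf⟩ := exists_injective_nat (CPLForm V)
  (encode_injective hf).countable

theorem nonempty_cplForm (α : QGForm V) : Nonempty (CPLForm V) := by
  induction α with
  | bel φ => exact ⟨φ⟩
  | _ => assumption

end QGForm

namespace QGDerivable

open QGForm

variable {V : Type u} {Ξ Δ : Set (QGForm V)} {α β γ : QGForm V}

theorem mono (h : QGDerivable Ξ α) (hΞ : Ξ ⊆ Δ) : QGDerivable Δ α := by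
  induction h generalizing Δ with
  | hyp h => exact .hyp (hΞ h)
  | biG h => exact .biG h
  | nontriv τ hφ hχ => exact .nontriv τ hφ hχ
  | reg h => exact .reg h
  | mp _ _ ih₁ ih₂ => exact .mp (ih₁ hΞ) (ih₂ hΞ)
  | nec τ h _ => exact .nec τ h

theorem weaken (h : QGDerivable Ξ α) : QGDerivable (insert β Ξ) α :=
  h.mono (Set.subset_insert _ _)

theorem assumption : QGDerivable (insert α Ξ) α := .hyp (Set.mem_insert _ _)

theorem exists_finite (h : QGDerivable Ξ α) : ∃ s ⊆ Ξ, s.Finite ∧ QGDerivable s α := by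
  induction h with
  | hyp h => exact ⟨{_}, Set.singleton_subset_iff.2 h, Set.finite_singleton _, .hyp rfl⟩
  | biG h => exact ⟨∅, Set.empty_subset _, Set.finite_empty, .biG h⟩
  | nontriv τ hφ hχ => exact ⟨∅, Set.empty_subset _, Set.finite_empty, .nontriv τ hφ hχ⟩
  | reg h => exact ⟨∅, Set.empty_subset _, Set.finite_empty, .reg h⟩
  | mp _ _ ih₁ ih₂ =>
    obtain ⟨s, hs, hsf, ds⟩ := ih₁
    obtain ⟨t, ht, htf, dt⟩ := ih₂
    exact ⟨s ∪ t, Set.union_subset hs ht, hsf.union htf,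
      .mp (ds.mono Set.subset_union_left) (dt.mono Set.subset_union_right)⟩
  | nec τ h _ => exact ⟨∅, Set.empty_subset _, Set.finite_empty, .nec τ h⟩

theorem isOfFiniteCharacter_not (α : QGForm V) :
    Order.IsOfFiniteCharacter {Ξ | ¬ QGDerivable Ξ α} := fun _ =>
  ⟨fun h _ hs _ d => h (d.mono hs), fun h d =>
    have ⟨s, hs, hsf, ds⟩ := d.exists_finite
    h s hs hsf ds⟩

theorem const_imp (h : QGDerivable Ξ α) : QGDerivable Ξ (imp β α) :=
  .mp h (.mp (.biG (.andE₁ α β)) (.biG (.curry α β α)))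

theorem imp_self (α : QGForm V) : QGDerivable Ξ (imp α α) :=
  .mp (.biG (.andE₁ α α)) (.mp (.biG (.andE₂ _ α)) (.biG (.curry _ α α)))

theorem imp_trans (h₁ : QGDerivable Ξ (imp α β)) (h₂ : QGDerivable Ξ (imp β γ)) :
    QGDerivable Ξ (imp α γ) :=
  .mp h₂ (.mp h₁ (.biG (.trans α β γ)))

theorem imp_and (h₁ : QGDerivable Ξ (imp α β)) (h₂ : QGDerivable Ξ (imp α γ)) :
    QGDerivable Ξ (imp α (and β γ)) :=
  .mp h₂ (.mp h₁ (.biG (.andI α β γ)))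

theorem imp_mp (h₁ : QGDerivable Ξ (imp α (imp β γ))) (h₂ : QGDerivable Ξ (imp α β)) :
    QGDerivable Ξ (imp α γ) :=
  imp_trans (imp_and (imp_self α) h₂) (.mp h₁ (.biG (.uncurry α β γ)))

theorem or_imp (h₁ : QGDerivable Ξ (imp α γ)) (h₂ : QGDerivable Ξ (imp β γ)) :
    QGDerivable Ξ (imp (or α β) γ) :=
  .mp h₂ (.mp h₁ (.biG (.orE α β γ)))

theorem deduction (h : QGDerivable (insert α Ξ) β) : QGDerivable Ξ (imp α β) := by
  generalize hΔ : insert α Ξ = Δ at h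
  induction h with
  | hyp h =>
    subst hΔ
    rcases h with rfl | h
    exacts [imp_self _, const_imp (.hyp h)]
  | biG h => exact const_imp (.biG h)
  | nontriv τ hφ hχ => exact const_imp (.nontriv τ hφ hχ)
  | reg h => exact const_imp (.reg h)
  | mp _ _ ih₁ ih₂ => exact imp_mp (ih₂ hΔ) (ih₁ hΔ)
  | nec τ h _ => exact const_imp (.nec τ h)

theorem or_inl (h : QGDerivable Ξ α) : QGDerivable Ξ (or α β) := .mp h (.biG (.orI₁ α β))

theorem or_inr (h : QGDerivable Ξ β) : QGDerivable Ξ (or α β) := .mp h (.biG (.orI₂ α β))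

theorem or_elim (h : QGDerivable Ξ (or α β)) (h₁ : QGDerivable (insert α Ξ) γ)
    (h₂ : QGDerivable (insert β Ξ) γ) : QGDerivable Ξ γ :=
  .mp h (or_imp h₁.deduction h₂.deduction)

theorem coimp_imp_of_delta {τ : QGForm V} (h : QGDerivable Ξ (delta τ (imp α (or β γ)))) :
    QGDerivable Ξ (imp (coimp α β) γ) := by
  have hneg : QGDerivable Ξ (neg τ (coimp α (or β γ))) :=
    imp_trans (.biG (.coimp_top τ α (or β γ))) h
  exact .mp (imp_trans (.biG (.coimp_coimp α β γ)) hneg) (.biG (.neg_coimp τ _ _))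

theorem coimp_imp (h : QGDerivable ∅ (imp α (or β γ))) : QGDerivable Ξ (imp (coimp α β) γ) :=
  coimp_imp_of_delta (.nec α h)

theorem bot_imp (τ α : QGForm V) : QGDerivable Ξ (imp (bot τ) α) :=
  coimp_imp (.biG (.orI₁ τ α))

theorem neg_or_neg_neg (τ α : QGForm V) : QGDerivable Ξ (or (neg τ α) (neg τ (neg τ α))) := by
  refine or_elim (.biG (.prel α (neg τ α))) (or_inl (deduction ?_)) (or_inr (deduction ?_))
  · exact .mp assumption (.mp assumption assumption.weaken)
  · exact .mp (.mp assumption assumption.weaken) assumption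

theorem neg_or_neg_of_neg_and {τ : QGForm V} (h : QGDerivable Ξ (neg τ (and α β))) :
    QGDerivable Ξ (or (neg τ α) (neg τ β)) := by
  refine or_elim (.biG (.prel α β)) (or_inl ?_) (or_inr ?_)
  · exact imp_trans (imp_and (imp_self α) assumption) h.weaken
  · exact imp_trans (imp_and assumption (imp_self β)) h.weaken

theorem or_top_coimp (τ α : QGForm V) : QGDerivable Ξ (or α (coimp (top τ) α)) :=
  .mp (imp_self τ) (.biG (.coimp_or (top τ) α))

theorem neg_imp_delta {τ : QGForm V} (σ : QGForm V)
    (h : QGDerivable ∅ (or α (neg τ (neg τ β)))) :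
    QGDerivable Ξ (imp (neg τ β) (delta σ α)) := by
  have hcoimp : QGDerivable Ξ (imp (coimp (top σ) α) (neg τ (neg τ β))) :=
    coimp_imp (const_imp h)
  refine deduction (deduction (.mp ?_ (bot_imp τ _)))
  exact .mp assumption.weaken (.mp assumption hcoimp.weaken.weaken)

theorem delta_imp (τ α : QGForm V) : QGDerivable Ξ (imp (delta τ α) α) :=
  deduction (or_elim (or_top_coimp τ α) assumption
    (.mp (.mp assumption assumption.weaken) (bot_imp τ α)))

theorem delta_imp_delta (τ σ α : QGForm V) : QGDerivable Ξ (imp (delta τ α) (delta σ α)) :=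
  neg_imp_delta σ (or_elim (or_top_coimp τ α) (or_inl assumption)
    (or_inr (deduction (.mp assumption.weaken assumption))))

theorem delta_imp_delta_delta (τ σ α : QGForm V) :
    QGDerivable Ξ (imp (delta τ α) (delta τ (delta σ α))) :=
  neg_imp_delta τ (or_elim (neg_or_neg_neg τ (coimp (top τ) α))
    (or_inl (.mp assumption (delta_imp_delta τ σ α))) (or_inr assumption))

theorem delta_imp_distrib (τ α β : QGForm V) :
    QGDerivable Ξ (imp (delta τ (imp α β)) (imp (delta τ α) (delta τ β))) := by
  have hcoimp : QGDerivable Ξ (imp (coimp (top τ) β)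
      (or (coimp (top τ) (imp α β)) (coimp (top τ) α))) := by
    refine coimp_imp (const_imp (or_elim (or_top_coimp τ (imp α β))
      (or_elim (or_top_coimp τ α) (or_inl ?_) (or_inr (or_inr assumption)))
      (or_inr (or_inl assumption))))
    exact .mp assumption assumption.weaken
  refine deduction (deduction (imp_trans hcoimp.weaken.weaken (or_imp ?_ ?_)))
  exacts [assumption.weaken, assumption]

theorem delta_imp_or_delta_imp (τ α β : QGForm V) :
    QGDerivable Ξ (or (delta τ (imp α β)) (delta τ (imp β α))) := by
  have hneg (α β : QGForm V) :
      QGDerivable (insert (neg τ (coimp α β)) Ξ) (delta τ (imp α β)) :=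
    .mp assumption (neg_imp_delta τ (or_elim (neg_or_neg_neg τ (coimp α β))
      (or_inl (.mp assumption (.biG (.neg_coimp τ α β)))) (or_inr assumption)))
  exact or_elim (neg_or_neg_of_neg_and (.biG (.coprel τ α β)))
    (or_inl (hneg α β)) (or_inr (hneg β α))

theorem delta_image (τ : QGForm V) (h : QGDerivable Ξ α) :
    QGDerivable (delta τ '' Ξ) (delta τ α) := by
  induction h with
  | hyp h => exact .hyp (Set.mem_image_of_mem _ h)
  | biG h => exact .nec τ (.biG h)
  | nontriv σ hφ hχ => exact .nec τ (.nontriv σ hφ hχ)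
  | reg h => exact .nec τ (.reg h)
  | mp _ _ ih₁ ih₂ => exact .mp ih₁ (.mp ih₂ (delta_imp_distrib τ _ _))
  | nec σ h _ => exact .nec τ (.nec σ h)

end QGDerivable

section Theories

open QGForm QGDerivable

variable {V : Type u} {Ξ F T : Set (QGForm V)} {α β γ : QGForm V}

/-- Prime theories: deductively closed sets of formulas with the disjunction property. Properness
is not required; where it matters, an explicit formula outside the theory is at hand. -/
structure IsPrimeTheory (F : Set (QGForm V)) : Prop where
  closed {α : QGForm V} : QGDerivable F α → α ∈ F
  mem_or_mem {α β : QGForm V} : or α β ∈ F → α ∈ F ∨ β ∈ F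

/-- Linear theories: deductively closed sets of formulas that are closed under `△` and comparable
in the sense that one of `α → β` and `β → α` belongs to the set. They are the theories whose
Lindenbaum algebra is a chain. -/
structure IsLinearTheory (T : Set (QGForm V)) : Prop where
  closed {α : QGForm V} : QGDerivable T α → α ∈ T
  delta_mem (τ : QGForm V) {α : QGForm V} : α ∈ T → delta τ α ∈ T
  imp_mem_or_imp_mem (α β : QGForm V) : imp α β ∈ T ∨ imp β α ∈ T

/-- The crisp part of a theory: the formulas whose `△` belongs to it. For a prime theory it records
which values are at most which, and is therefore a linear theory. The formula `τ` is the one in the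
abbreviation `△`. -/
def crispPart (τ : QGForm V) (F : Set (QGForm V)) : Set (QGForm V) := {α | delta τ α ∈ F}

theorem exists_isPrimeTheory (h : ¬ QGDerivable Ξ α) :
    ∃ F, IsPrimeTheory F ∧ Ξ ⊆ F ∧ α ∉ F := by
  obtain ⟨F, hΞ, hF⟩ := (isOfFiniteCharacter_not α).exists_maximal h
  have derivable_insert {β : QGForm V} (hβ : β ∉ F) : QGDerivable (insert β F) α :=
    not_not.1 (mt hF.mem_of_prop_insert hβ)
  refine ⟨F, ⟨fun {β} d => ?_, fun {β γ} hor => ?_⟩, hΞ, fun hα => hF.prop (.hyp hα)⟩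
  · by_contra hβ
    exact hF.prop (.mp d (derivable_insert hβ).deduction)
  · by_contra! hβγ
    exact hF.prop (or_elim (.hyp hor) (derivable_insert hβγ.1) (derivable_insert hβγ.2))

theorem IsPrimeTheory.crispPart_subset (hF : IsPrimeTheory F) (τ : QGForm V) :
    crispPart τ F ⊆ F := fun _ hα =>
  hF.closed (.mp (.hyp hα) (delta_imp τ _))

theorem IsPrimeTheory.isLinearTheory_crispPart (hF : IsPrimeTheory F) (τ : QGForm V) :
    IsLinearTheory (crispPart τ F) where
  closed d := hF.closed ((d.delta_image τ).mono (Set.image_subset_iff.2 subset_rfl))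
  delta_mem σ _ hα := hF.closed (.mp (.hyp hα) (delta_imp_delta_delta τ σ _))
  imp_mem_or_imp_mem α β := hF.mem_or_mem (hF.closed (delta_imp_or_delta_imp τ α β))

theorem exists_isLinearTheory (h : ¬ QGDerivable Ξ α) :
    ∃ T, IsLinearTheory T ∧ α ∉ T ∧ ∀ γ ∈ Ξ, imp γ α ∉ T := by
  obtain ⟨F, hF, hΞ, hα⟩ := exists_isPrimeTheory h
  have hsub := hF.crispPart_subset α
  exact ⟨crispPart α F, hF.isLinearTheory_crispPart α, fun h => hα (hsub h),
    fun γ hγ h => hα (hF.closed (.mp (.hyp (hΞ hγ)) (.hyp (hsub h))))⟩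

/-- The order of the Lindenbaum algebra of a linear theory, as a preorder on formulas. -/
abbrev IsLinearTheory.preorder (hT : IsLinearTheory T) : Preorder (QGForm V) where
  le α β := imp α β ∈ T
  le_refl α := hT.closed (imp_self α)
  le_trans _ _ _ h₁ h₂ := hT.closed (imp_trans (.hyp h₁) (.hyp h₂))

end Theories

section UnitInterval

theorem exists_orderIso_Icc_unitInterval {a b : ℝ} (hab : a < b) :
    Nonempty (Set.Icc a b ≃o unitInterval) :=
  ⟨(iccHomeoI a b hab).toEquiv, fun {x y} => by
    rw [← Subtype.coe_le_coe, ← Subtype.coe_le_coe]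
    simp only [Homeomorph.coe_toEquiv, iccHomeoI_apply_coe,
      div_le_div_iff_of_pos_right (sub_pos.2 hab), sub_le_sub_iff_right]⟩

-- Doubling every point of the order before embedding it opens a gap above each of its points.
theorem exists_orderEmbedding_real_with_gaps (X : Type*) [LinearOrder X] [Countable X] :
    ∃ f : X ↪o ℝ, ∀ x, ∃ c, f x < c ∧ ∀ y, x < y → c ≤ f y := by
  have : Countable (X ×ₗ Bool) := inferInstanceAs (Countable (X × Bool))
  obtain ⟨f⟩ := Order.embedding_from_countable_to_dense (X ×ₗ Bool) ℝ
  refine ⟨.ofMapLEIff (fun x => f (toLex (x, false))) fun x y => ?_,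
    fun x => ⟨f (toLex (x, true)), ?_, fun y hxy => ?_⟩⟩
  · rw [f.le_iff_le, Prod.Lex.toLex_le_toLex]
    simp [le_iff_lt_or_eq]
  · simp [Prod.Lex.toLex_lt_toLex]
  · simp [Prod.Lex.toLex_le_toLex, hxy]

theorem exists_orderEmbedding_unitInterval_with_gap {X : Type*} [LinearOrder X] [Countable X]
    {b t x : X} (hb : IsBot b) (ht : IsTop t) (hx : x < t) :
    ∃ (g : X ↪o unitInterval) (c : unitInterval),
      g b = 0 ∧ g t = 1 ∧ g x < c ∧ ∀ y, x < y → c ≤ g y := by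
  obtain ⟨f, hf⟩ := exists_orderEmbedding_real_with_gaps X
  obtain ⟨c, hxc, hc⟩ := hf x
  have hbt : f b < f t := f.lt_iff_lt.2 ((hb x).trans_lt hx)
  obtain ⟨e⟩ := exists_orderIso_Icc_unitInterval hbt
  have : Fact (f b ≤ f t) := ⟨hbt.le⟩
  have hmem (y : X) : f y ∈ Set.Icc (f b) (f t) := ⟨f.monotone (hb y), f.monotone (ht y)⟩
  have hcmem : c ∈ Set.Icc (f b) (f t) := ⟨(hmem x).1.trans hxc.le, hc t hx⟩
  refine ⟨.ofMapLEIff (fun y => e ⟨f y, hmem y⟩) fun y z => ?_, e ⟨c, hcmem⟩,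
    e.map_bot, e.map_top, e.lt_iff_lt.2 hxc, fun y hy => e.le_iff_le.2 (hc y hy)⟩
  simp

theorem exists_monotone_comp_eq {ι α β : Type*} [Preorder α] [CompleteLattice β] {E : ι → α}
    {g : ι → β} (h : ∀ i j, E i ≤ E j → g i ≤ g j) :
    ∃ m : α → β, Monotone m ∧ ∀ i, m (E i) = g i :=
  ⟨fun x => ⨆ (i) (_ : E i ≤ x), g i,
    fun _ _ hxy => iSup_mono fun _ => iSup_mono' fun hi => ⟨hi.trans hxy, le_rfl⟩,
    fun i => le_antisymm (iSup₂_le fun j hj => h j i hj) (le_iSup₂_of_le i le_rfl le_rfl)⟩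

theorem le_goedelImp_iff {a b c : unitInterval} : c ≤ goedelImp a b ↔ min c a ≤ b := by
  unfold goedelImp
  split_ifs with h
  · simp [h, unitInterval.le_one']
  · simp [h]

theorem goedelCoimp_le_iff {a b c : unitInterval} : goedelCoimp a b ≤ c ↔ a ≤ max b c := by
  unfold goedelCoimp
  split_ifs with h
  · simp [h]
  · simp [h]

theorem one_le_goedelImp_iff {a b : unitInterval} : 1 ≤ goedelImp a b ↔ a ≤ b := by
  rw [le_goedelImp_iff, min_eq_right unitInterval.le_one']

end UnitInterval

section Representations

open QGForm QGDerivable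

variable {V : Type u} {T : Set (QGForm V)} {g : QGForm V → unitInterval} {α β : QGForm V}

/-- Representations of a theory in the unit interval: order embeddings of its Lindenbaum algebra
that preserve the endpoints, as functions on formulas. -/
structure IsOrderRepresentation (T : Set (QGForm V)) (g : QGForm V → unitInterval) : Prop where
  le_iff {α β : QGForm V} : g α ≤ g β ↔ imp α β ∈ T
  map_bot (τ : QGForm V) : g (bot τ) = 0
  map_top (τ : QGForm V) : g (top τ) = 1

theorem IsLinearTheory.exists_isOrderRepresentation [Countable V] (hT : IsLinearTheory T)
    (hα : α ∉ T) : ∃ (g : QGForm V → unitInterval) (c : unitInterval),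
      IsOrderRepresentation T g ∧ g α < c ∧ ∀ β, imp β α ∉ T → c ≤ g β := by
  classical
  let := hT.preorder
  have : Std.Total (α := QGForm V) (· ≤ ·) := ⟨hT.imp_mem_or_imp_mem⟩
  have : Countable (Antisymmetrization (QGForm V) (· ≤ ·)) := Quotient.countable
  let q : QGForm V → Antisymmetrization (QGForm V) (· ≤ ·) := toAntisymmetrization _
  have le_q {β γ : QGForm V} : q β ≤ q γ ↔ imp β γ ∈ T :=
    toAntisymmetrization_le_toAntisymmetrization_iff
  have isBot_bot (τ : QGForm V) : IsBot (q (bot τ)) :=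
    Quotient.ind fun β => le_q.2 (hT.closed (bot_imp τ β))
  have isTop_top (τ : QGForm V) : IsTop (q (top τ)) :=
    Quotient.ind fun β => le_q.2 (hT.closed (const_imp (imp_self τ)))
  have lt_top : q α < q (top α) :=
    lt_of_not_ge fun h => hα (hT.closed (.mp (imp_self α) (.hyp (le_q.1 h))))
  obtain ⟨g, c, hg₀, hg₁, hαc, hc⟩ :=
    exists_orderEmbedding_unitInterval_with_gap (isBot_bot α) (isTop_top α) lt_top
  refine ⟨g ∘ q, c, ⟨g.le_iff_le.trans le_q, fun τ => ?_, fun τ => ?_⟩, hαc,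
    fun β hβ => hc _ (lt_of_not_ge (mt le_q.1 hβ))⟩
  · exact hg₀ ▸ congrArg g ((isBot_bot τ _).antisymm (isBot_bot α _))
  · exact hg₁ ▸ congrArg g ((isTop_top α _).antisymm (isTop_top τ _))

namespace IsOrderRepresentation

variable (hg : IsOrderRepresentation T g) (hT : IsLinearTheory T)

include hg hT

theorem le_of_derivable (h : QGDerivable T (imp α β)) : g α ≤ g β := hg.le_iff.2 (hT.closed h)

theorem eq_one_of_mem (hα : α ∈ T) : g α = 1 :=
  le_antisymm unitInterval.le_one'
    (hg.map_top α ▸ hg.le_of_derivable hT (const_imp (.hyp hα)))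

theorem bot_notMem (τ : QGForm V) : bot τ ∉ T := fun h =>
  zero_ne_one ((hg.map_bot τ).symm.trans (hg.eq_one_of_mem hT h))

theorem map_and (α β : QGForm V) : g (and α β) = min (g α) (g β) := by
  refine le_antisymm (le_min ?_ ?_)
    (min_le_iff.2 ((hT.imp_mem_or_imp_mem α β).imp (fun h => ?_) fun h => ?_))
  · exact hg.le_of_derivable hT (.biG (.andE₁ α β))
  · exact hg.le_of_derivable hT (.biG (.andE₂ α β))
  · exact hg.le_of_derivable hT (imp_and (imp_self α) (.hyp h))
  · exact hg.le_of_derivable hT (imp_and (.hyp h) (imp_self β))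

theorem map_or (α β : QGForm V) : g (or α β) = max (g α) (g β) := by
  refine le_antisymm
    (le_max_iff.2 ((hT.imp_mem_or_imp_mem β α).imp (fun h => ?_) fun h => ?_)) (max_le ?_ ?_)
  · exact hg.le_of_derivable hT (or_imp (imp_self α) (.hyp h))
  · exact hg.le_of_derivable hT (or_imp (.hyp h) (imp_self β))
  · exact hg.le_of_derivable hT (.biG (.orI₁ α β))
  · exact hg.le_of_derivable hT (.biG (.orI₂ α β))

theorem map_imp (α β : QGForm V) : g (imp α β) = goedelImp (g α) (g β) := by
  apply le_antisymm
  · rw [le_goedelImp_iff, ← hg.map_and hT]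
    exact hg.le_of_derivable hT (.mp (imp_self _) (.biG (.uncurry _ α β)))
  · unfold goedelImp
    split_ifs with h
    · exact (hg.eq_one_of_mem hT (hg.le_iff.1 h)).ge
    · exact hg.le_of_derivable hT (.mp (.biG (.andE₁ β α)) (.biG (.curry β α β)))

theorem map_coimp (α β : QGForm V) : g (coimp α β) = goedelCoimp (g α) (g β) := by
  apply le_antisymm
  · unfold goedelCoimp
    split_ifs with h
    · have hor : imp α (or β (bot α)) ∈ T :=
        hT.closed (imp_trans (.hyp (hg.le_iff.1 h)) (.biG (.orI₁ β (bot α))))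
      exact hg.map_bot α ▸
        hg.le_of_derivable hT (coimp_imp_of_delta (.hyp (hT.delta_mem α hor)))
    · exact hg.le_of_derivable hT (coimp_imp (.biG (.orI₂ β α)))
  · rw [goedelCoimp_le_iff, ← hg.map_or hT]
    exact hg.le_of_derivable hT (.biG (.coimp_or α β))

theorem eval_eq {M : QGModel.{u, w} V} (hM : ∀ φ, M.eval (bel φ) = g (bel φ)) (α : QGForm V) :
    M.eval α = g α := by
  induction α with
  | bel φ => exact hM φ
  | and α β ih₁ ih₂ => rw [QGModel.eval, ih₁, ih₂, hg.map_and hT]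
  | or α β ih₁ ih₂ => rw [QGModel.eval, ih₁, ih₂, hg.map_or hT]
  | imp α β ih₁ ih₂ => rw [QGModel.eval, ih₁, ih₂, hg.map_imp hT]
  | coimp α β ih₁ ih₂ => rw [QGModel.eval, ih₁, ih₂, hg.map_coimp hT]

end IsOrderRepresentation

end Representations

namespace QGModel

variable {V : Type u} (M : QGModel.{u, w} V) {φ ψ : CPLForm V}

theorem sat_iff_holds (x : M.W) (φ : CPLForm V) : M.Sat x φ ↔ φ.Holds fun p => x ∈ M.v p := by
  induction φ with
  | var p => rfl
  | neg φ ih => exact not_congr ih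
  | and φ ψ ih₁ ih₂ => exact and_congr ih₁ ih₂

theorem ext_eq_univ (h : φ.Provable) : M.ext φ = Set.univ :=
  Set.eq_univ_of_forall fun x => (M.sat_iff_holds x φ).2 (CPLForm.provable_iff_forall_holds.1 h _)

theorem ext_eq_empty (h : φ.neg.Provable) : M.ext φ = ∅ :=
  Set.compl_univ_iff.1 (M.ext_eq_univ h)

theorem ext_subset_ext (h : (φ.imp ψ).Provable) : M.ext φ ⊆ M.ext ψ := fun x hx =>
  (M.sat_iff_holds x ψ).2 (CPLForm.holds_imp.1 (CPLForm.provable_iff_forall_holds.1 h _)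
    ((M.sat_iff_holds x φ).1 hx))

end QGModel

section CanonicalModel

open QGForm

variable {V : Type u} {T : Set (QGForm V)} {g : QGForm V → unitInterval}

/-- The event expressed by a classical formula in the space of all classical valuations, the states
of the canonical model. The space is shrunk to the universe of the states of the models. -/
def CPLForm.truthSet [Small.{w} V] (φ : CPLForm V) : Set (Shrink.{w} (V → Prop)) :=
  {x | φ.Holds ((equivShrink _).symm x)}

theorem CPLForm.provable_imp_of_truthSet_subset [Small.{w} V] {φ ψ : CPLForm V}
    (h : truthSet.{u, w} φ ⊆ truthSet ψ) : (φ.imp ψ).Provable := by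
  refine provable_iff_forall_holds.2 fun v => holds_imp.2 fun hφ => ?_
  simpa only [truthSet, Set.mem_ofPred_eq, Equiv.symm_apply_apply] using
    @h (equivShrink _ v) (by simpa only [truthSet, Set.mem_ofPred_eq, Equiv.symm_apply_apply])

/-- The canonical model of an uncertainty measure on the space of all classical valuations. -/
def QGModel.canonical [Small.{w} V] (μ : UncertaintyMeasure (Shrink.{w} (V → Prop))) :
    QGModel.{u, w} V where
  W := Shrink.{w} (V → Prop)
  nonempty := inferInstance
  v p := {x | (equivShrink _).symm x p}
  μ := μ

theorem QGModel.canonical_ext [Small.{w} V] (μ : UncertaintyMeasure (Shrink.{w} (V → Prop)))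
    (φ : CPLForm V) : (canonical μ).ext φ = φ.truthSet :=
  Set.ext fun x => (canonical μ).sat_iff_holds x φ

namespace IsOrderRepresentation

variable (hg : IsOrderRepresentation T g) (hT : IsLinearTheory T)

include hg hT

theorem bel_lt_bel {φ χ : CPLForm V} (hφ : φ.Provable) (hχ : χ.neg.Provable) :
    g (bel χ) < g (bel φ) :=
  lt_of_not_ge fun h => hg.bot_notMem hT (bel φ) (hT.closed
    (.mp (.hyp (hT.delta_mem (bel φ) (hg.le_iff.1 h))) (.nontriv (bel φ) hφ hχ)))

theorem exists_uncertaintyMeasure [Small.{w} V] [Nonempty (CPLForm V)] :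
    ∃ μ : UncertaintyMeasure (Shrink.{w} (V → Prop)), ∀ φ, μ.toFun φ.truthSet = g (bel φ) := by
  obtain ⟨m, hm, hmg⟩ := exists_monotone_comp_eq (E := CPLForm.truthSet.{u, w})
    (g := fun φ => g (bel φ)) fun φ ψ h =>
      hg.le_of_derivable hT (.reg (CPLForm.provable_imp_of_truthSet_subset h))
  obtain ⟨φ₀⟩ := ‹Nonempty (CPLForm V)›
  let falsum : CPLForm V := φ₀.and φ₀.neg
  have holds_neg (v : V → Prop) : falsum.neg.Holds v := fun h => h.2 h.1
  have provable_neg : falsum.neg.Provable := CPLForm.provable_iff_forall_holds.2 holds_neg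
  have truthSet_neg : falsum.neg.truthSet = (Set.univ : Set (Shrink.{w} (V → Prop))) :=
    Set.eq_univ_of_forall fun _ => holds_neg _
  have truthSet_eq : falsum.truthSet = (∅ : Set (Shrink.{w} (V → Prop))) :=
    Set.eq_empty_of_forall_notMem fun _ => holds_neg _
  exact ⟨⟨m, fun _ _ h => hm h, by
    rw [← truthSet_eq, ← truthSet_neg, hmg, hmg]
    exact hg.bel_lt_bel hT provable_neg provable_neg⟩, hmg⟩

theorem exists_model [Small.{w} V] [Nonempty (CPLForm V)] :
    ∃ M : QGModel.{u, w} V, ∀ α, M.eval α = g α := by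
  obtain ⟨μ, hμ⟩ := exists_uncertaintyMeasure.{u, w} hg hT
  refine ⟨.canonical μ, hg.eval_eq hT fun φ => ?_⟩
  rw [← hμ, QGModel.eval, QGModel.canonical_ext]
  rfl

end IsOrderRepresentation

theorem exists_model_of_not_derivable [Countable V] {Ξ : Set (QGForm V)} {α : QGForm V}
    (h : ¬ QGDerivable Ξ α) :
    ∃ (M : QGModel.{u, w} V) (c : unitInterval), M.eval α < c ∧ ∀ γ ∈ Ξ, c ≤ M.eval γ := by
  obtain ⟨T, hT, hα, hΞ⟩ := exists_isLinearTheory h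
  obtain ⟨g, c, hg, hαc, hc⟩ := hT.exists_isOrderRepresentation hα
  have := α.nonempty_cplForm
  obtain ⟨M, hM⟩ := IsOrderRepresentation.exists_model.{u, w} hg hT
  exact ⟨M, c, hM α ▸ hαc, fun γ hγ => hM γ ▸ hc γ (hΞ γ hγ)⟩

end CanonicalModel

section Soundness

open QGForm

variable {V : Type u} {α : QGForm V}

theorem BiGAxiom.one_le_eval (h : BiGAxiom α) (M : QGModel.{u, w} V) : 1 ≤ M.eval α := by
  have nonneg (x : unitInterval) : 0 ≤ x := unitInterval.nonneg'
  have le_one (x : unitInterval) : x ≤ 1 := unitInterval.le_one'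
  cases h <;> simp only [QGModel.eval, top, bot, neg, one_le_goedelImp_iff] <;>
    (try simp only [goedelImp, goedelCoimp, le_refl, if_true]) <;> grind

namespace QGModel

variable (M : QGModel.{u, w} V)

theorem eval_delta (τ α : QGForm V) : M.eval (delta τ α) = if M.eval α = 1 then 1 else 0 := by
  have one_le_iff : 1 ≤ M.eval α ↔ M.eval α = 1 := unitInterval.le_one'.ge_iff_eq
  by_cases hα : M.eval α = 1 <;>
    simp [eval, delta, top, bot, goedelImp, goedelCoimp, one_le_iff, hα]

theorem eval_bel_lt_eval_bel {φ χ : CPLForm V} (hφ : φ.Provable) (hχ : χ.neg.Provable) :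
    M.eval (bel χ) < M.eval (bel φ) := by
  simpa only [eval, M.ext_eq_univ hφ, M.ext_eq_empty hχ] using M.μ.nontrivial

end QGModel

theorem QGDerivable.entails {Ξ : Set (QGForm V)} (h : QGDerivable Ξ α) :
    QGEntails.{u, w} Ξ α := by
  intro M
  induction h with
  | hyp h => exact sInf_le (Set.mem_image_of_mem _ h)
  | biG h => exact unitInterval.le_one'.trans (h.one_le_eval M)
  | nontriv τ hφ hχ =>
    have himp := mt (one_le_goedelImp_iff.1 ∘ Eq.ge) (M.eval_bel_lt_eval_bel hφ hχ).not_ge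
    refine unitInterval.le_one'.trans (one_le_goedelImp_iff.2 ?_)
    rw [M.eval_delta, QGModel.eval, if_neg himp]
    exact unitInterval.nonneg'
  | reg h =>
    exact unitInterval.le_one'.trans
      (one_le_goedelImp_iff.2 (M.μ.mono _ _ (M.ext_subset_ext h)))
  | mp _ _ ih₁ ih₂ => exact (le_min le_rfl ih₁).trans (le_goedelImp_iff.1 ih₂)
  | @nec _ τ β _ ih =>
    have hβ : M.eval β = 1 := top_le_iff.1 (by simpa only [Set.image_empty, sInf_empty] using ih)
    rw [M.eval_delta, if_pos hβ]
    exact unitInterval.le_one'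

end Soundness

theorem mainTheorem1 {V : Type u} [Countable V] (Ξ : Set (QGForm V)) (α : QGForm V) :
    QGEntails.{u, w} Ξ α ↔ QGDerivable Ξ α := by
  refine ⟨fun h => ?_, fun h => h.entails⟩
  by_contra hα
  obtain ⟨M, c, hαc, hc⟩ := exists_model_of_not_derivable.{u, w} hα
  exact (h M).not_gt (hαc.trans_le (le_sInf (Set.forall_mem_image.2 hc)))
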